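/- **Theorem.** Let $p\in(0,1)$, and for every $n\ge 1$ let $G_n\sim\mathbb{G}_{n,p}$ be an Erdős–Rényi random graph on $n$ vertices (each pair of vertices is an edge independently with probability $p$), all defined on one probability space with an arbitrary joint distribution. For a graph $G$ on $n$ vertices let $m_k(G)$ be the number of matchings of $G$ with exactly $k$ edges, and let $$\mu(G,x)=\sum_{k=0}^{\lfloor n/2\rfloor}(-1)^k m_k(G)\,x^{n-2k}$$ be its matching polynomial. Let $\pi_n$ be the uniform probability measure on the multiset of the $n$ complex roots of $\mu(G_n,x)$ (roots counted with multiplicity), and let $\lambda_n(X):=\pi_n(\sqrt n\,X)$ for Borel sets $X\subseteq\mathbb{C}$. Then, almost surely, the probability measures $\lambda_n$ converge weakly, as $n\to\infty$, to the semicircle distribution $SC_p$, that is, the probability measure carried by the real line (regarded as a subset of $\mathbb{C}$) with density $$\rho_p(x)=\frac1{2\pi\sqrt p}\sqrt{4-\frac{x^2}{p}},\qquad -2\sqrt p\le x\le 2\sqrt p,$$ with respect to Lebesgue measure on the line. -/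

import Mathlib

open MeasureTheory ProbabilityTheory Filter Topology Polynomial

namespace SimpleGraph

variable {V : Type*}

/-- The number `m_k(G)` of `k`-matchings of `G`, i.e. of matchings with exactly `k` edges.
Mathlib's `Subgraph.IsMatching` requires every vertex of the subgraph to have exactly one
neighbour in it, so a matching has no isolated vertices and is determined by its edges. -/
noncomputable def matchingCount (G : SimpleGraph V) (k : ℕ) : ℕ :=
  {M : G.Subgraph | M.IsMatching ∧ M.edgeSet.ncard = k}.ncard

/-- The matching polynomial `μ(G, x) = ∑_{k=0}^{⌊n/2⌋} (-1)^k m_k(G) x^{n-2k}` of a finite graph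
on `n` vertices. -/
noncomputable def matchingPolynomial [Fintype V] (G : SimpleGraph V) : ℤ[X] :=
  ∑ k ∈ Finset.range (Fintype.card V / 2 + 1),
    C ((-1) ^ k * (G.matchingCount k : ℤ)) * X ^ (Fintype.card V - 2 * k)

theorem matchingCount_zero [Finite V] (G : SimpleGraph V) : G.matchingCount 0 = 1 := by
  rw [matchingCount, Set.ncard_eq_one]
  refine ⟨⊥, Set.eq_singleton_iff_unique_mem.2 ⟨⟨?_, by simp⟩, ?_⟩⟩
  · intro v hv
    simp at hv
  · rintro M ⟨hM, h0⟩
    rw [Set.ncard_eq_zero (Set.toFinite _)] at h0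
    have hadj : ∀ v w, ¬ M.Adj v w := fun v w h => by
      have h' := Subgraph.mem_edgeSet.2 h
      rw [h0] at h'
      exact h'
    have hv : M.verts = ∅ := by
      ext v
      simp only [Set.mem_empty_iff_false, iff_false]
      intro hv
      obtain ⟨w, hw, -⟩ := hM hv
      exact hadj v w hw
    ext v w
    · simp [hv]
    · simp [hadj v w]

theorem coeff_matchingPolynomial_card [Fintype V] (G : SimpleGraph V) :
    G.matchingPolynomial.coeff (Fintype.card V) = 1 := by
  rw [matchingPolynomial, finsetSum_coeff, Finset.sum_eq_single 0]
  · simp [matchingCount_zero]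
  · intro k hk hk0
    rw [Finset.mem_range] at hk
    rw [coeff_C_mul, coeff_X_pow, if_neg (by omega), mul_zero]
  · simp

theorem aroots_matchingPolynomial_ne_zero [Fintype V] [Nonempty V] (G : SimpleGraph V) :
    G.matchingPolynomial.aroots ℂ ≠ 0 := by
  have hc : (G.matchingPolynomial.map (algebraMap ℤ ℂ)).coeff (Fintype.card V) = 1 := by
    rw [coeff_map, coeff_matchingPolynomial_card, map_one]
  have hdeg : Fintype.card V ≤ (G.matchingPolynomial.map (algebraMap ℤ ℂ)).natDegree :=
    le_natDegree_of_ne_zero (by rw [hc]; exact one_ne_zero)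
  intro h
  have hs := (IsAlgClosed.splits (G.matchingPolynomial.map (algebraMap ℤ ℂ))).natDegree_eq_card_roots
  rw [aroots] at h
  rw [h, Multiset.card_zero] at hs
  have := Fintype.card_pos (α := V)
  omega

/-- The uniform probability measure on the multiset of (complex) roots of the matching polynomial,
i.e. each root is drawn with probability proportional to its multiplicity. -/
noncomputable def matchingMeasure [Fintype V] [Nonempty V] (G : SimpleGraph V) :
    ProbabilityMeasure ℂ :=
  ⟨(PMF.ofMultiset (G.matchingPolynomial.aroots ℂ)
    G.aroots_matchingPolynomial_ne_zero).toMeasure, inferInstance⟩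

/-- The rescaled measure `λ(X) = π(√n X)`, where `n` is the number of vertices and `π` is the
uniform measure on the roots: the image of `π` under `z ↦ z / √n`. -/
noncomputable def scaledMatchingMeasure [Fintype V] [Nonempty V] (G : SimpleGraph V) :
    ProbabilityMeasure ℂ :=
  G.matchingMeasure.map (f := fun z : ℂ => z / (Real.sqrt (Fintype.card V) : ℂ))
    (by fun_prop)

end SimpleGraph

/-- The density `ρ_p(x) = (1 / (2π√p)) √(4 - x²/p)` for `-2√p ≤ x ≤ 2√p`, and `0` elsewhere. -/
noncomputable def semicirclePDF (p : ℝ) : ℝ → ℝ :=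
  (Set.Icc (-2 * Real.sqrt p) (2 * Real.sqrt p)).indicator
    fun x => 1 / (2 * Real.pi * Real.sqrt p) * Real.sqrt (4 - x ^ 2 / p)

theorem semicirclePDF_nonneg (p x : ℝ) : 0 ≤ semicirclePDF p x :=
  Set.indicator_nonneg (fun x _ => by positivity) x

theorem lintegral_semicirclePDF {p : ℝ} (hp : 0 < p) :
    ∫⁻ x, ENNReal.ofReal (semicirclePDF p x) = 1 := by
  have hs : 0 < Real.sqrt p := Real.sqrt_pos.2 hp
  have hcont : Continuous fun x : ℝ =>
      1 / (2 * Real.pi * Real.sqrt p) * Real.sqrt (4 - x ^ 2 / p) := by fun_prop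
  have hint : Integrable (semicirclePDF p) :=
    (integrable_indicator_iff measurableSet_Icc).2
      (hcont.continuousOn.integrableOn_compact isCompact_Icc)
  rw [← ofReal_integral_eq_lintegral_ofReal hint (ae_of_all _ (semicirclePDF_nonneg p)),
    ENNReal.ofReal_eq_one, semicirclePDF, integral_indicator measurableSet_Icc,
    integral_Icc_eq_integral_Ioc, ← intervalIntegral.integral_of_le (by linarith)]
  have hfun : ∀ x : ℝ, 1 / (2 * Real.pi * Real.sqrt p) * Real.sqrt (4 - x ^ 2 / p) =
      1 / (Real.pi * Real.sqrt p) * Real.sqrt (1 - (x / (2 * Real.sqrt p)) ^ 2) := by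
    intro x
    have h4 : 4 - x ^ 2 / p = 2 ^ 2 * (1 - (x / (2 * Real.sqrt p)) ^ 2) := by
      rw [div_pow, mul_pow, Real.sq_sqrt hp.le]
      field_simp
      ring
    rw [h4, Real.sqrt_mul (by norm_num), Real.sqrt_sq (by norm_num)]
    field_simp
  simp_rw [hfun]
  rw [intervalIntegral.integral_const_mul,
    intervalIntegral.integral_comp_div (fun y => Real.sqrt (1 - y ^ 2)) (by positivity)]
  have h1 : -2 * Real.sqrt p / (2 * Real.sqrt p) = -1 := by field_simp
  have h2 : 2 * Real.sqrt p / (2 * Real.sqrt p) = 1 := by field_simp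
  rw [h1, h2, integral_sqrt_one_sub_sq, smul_eq_mul]
  field_simp

/-- The semicircle distribution `SC_p` on `ℝ`, with density `semicirclePDF p`. -/
noncomputable def semicircleReal (p : ℝ) (hp : 0 < p) : ProbabilityMeasure ℝ :=
  ⟨volume.withDensity fun x => ENNReal.ofReal (semicirclePDF p x),
    ⟨by rw [withDensity_apply _ MeasurableSet.univ, Measure.restrict_univ,
      lintegral_semicirclePDF hp]⟩⟩

/-- The semicircle distribution `SC_p`, regarded as a probability measure on the complex plane
carried by the real line. -/
noncomputable def semicircleComplex (p : ℝ) (hp : 0 < p) : ProbabilityMeasure ℂ :=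
  (semicircleReal p hp).map (f := fun x : ℝ => (x : ℂ)) (by fun_prop)

/-! For a vertex set `S`, put g_v(S) = μ(G[S] − v, z) / μ(G[S], z). The recurrence obtained by
matching v or leaving it unmatched gives g_v(S) = 1 / (z − Σ g_u(S − v)), the sum running over the
neighbours u of v in S. This continued fraction carries the whole proof.

First, it locates the zeros. Propagating the sign of the imaginary part shows that the roots are
real; propagating a norm bound shows that they have modulus at most 2√n. So every λ_n lives on [−2,
2].

Second, it computes the Stieltjes transform. Since μ' = Σ_v μ(G − v), the sum of 1/(z − θ) over the
roots θ is the sum of the g_v. Almost surely, eventually all degrees are pn + o(n) simultaneously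
(Hoeffding, union bound, Borel–Cantelli; only summability in n is needed, so the joint law of the
graphs is irrelevant). At z = √n·w with w = 1/r + pr and 0 < r ≤ 1/3, the quantities √n·g_v then
nearly satisfy x = 1/(w − p·x), which has r as a fixed point. One step of the recursion shrinks the
distance to r by a constant factor, so a number of steps independent of n suffices, and only
boundedly many vertices are deleted. Hence ∫ (1 − xr + pr²)⁻¹ dλ_n → 1
(`SimpleGraph.abs_stieltjes_sub_one_le`).

Third, this integrand is the generating function Σ U_k(x) r^k of rescaled Chebyshev polynomials.
Letting r be small isolates the coefficients one at a time: ∫ U_k dλ_n → 0 for every k ≥ 1, which is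
the value under SC_p. The U_k span all polynomials, and Weierstrass approximation on [−2, 2] gives
weak convergence (`tendsto_semicircleReal`). -/

namespace SimpleGraph

/-! ### Matching polynomials of induced subgraphs: recurrence and derivative -/

variable {V : Type*}

theorem Subgraph.IsMatching.two_mul_ncard_edgeSet [Finite V] {G : SimpleGraph V} {M : G.Subgraph}
    (h : M.IsMatching) : 2 * M.edgeSet.ncard = M.verts.ncard := by
  classical
  have := Fintype.ofFinite V
  rw [Subgraph.isMatching_iff_forall_degree] at h
  rw [← Subgraph.image_coe_edgeSet_coe,
    Set.ncard_image_of_injective _ (Sym2.map.injective Subtype.val_injective),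
    ← coe_edgeFinset, Set.ncard_coe_finset, ← M.coe.sum_degrees_eq_twice_card_edges]
  refine (Finset.sum_congr rfl fun x _ => ?_).trans
    ((Finset.card_eq_sum_ones (Finset.univ : Finset M.verts)).symm.trans ?_)
  · rw [← h x x.2, ← Subgraph.coe_degree]
    congr!
  · rw [Finset.card_univ, ← Nat.card_eq_fintype_card, Nat.card_coe_set_eq]

/-- The matchings of `G` all of whose vertices lie in `S`. -/
noncomputable def matchingsOn [Finite V] (G : SimpleGraph V) (S : Finset V) : Finset G.Subgraph :=
  (Set.toFinite {M : G.Subgraph | M.IsMatching ∧ M.verts ⊆ S}).toFinset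

@[simp]
theorem mem_matchingsOn [Finite V] {G : SimpleGraph V} {S : Finset V} {M : G.Subgraph} :
    M ∈ G.matchingsOn S ↔ M.IsMatching ∧ M.verts ⊆ S := by
  simp [matchingsOn]

/-- The matching polynomial of the subgraph of `G` induced on `S`. -/
noncomputable def matchingPolynomialOn [Finite V] (G : SimpleGraph V) (S : Finset V) : ℤ[X] :=
  ∑ M ∈ G.matchingsOn S, (-1) ^ M.edgeSet.ncard * X ^ (S.card - M.verts.ncard)

theorem matchingPolynomialOn_empty [Finite V] (G : SimpleGraph V) :
    G.matchingPolynomialOn ∅ = 1 := by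
  have : G.matchingsOn ∅ = {⊥} := by
    ext M
    simp only [mem_matchingsOn, Finset.coe_empty, Set.subset_empty_iff, Finset.mem_singleton]
    constructor
    · rintro ⟨-, h⟩
      ext v w
      · simp [h]
      · have : ¬ M.Adj v w := fun hv => by simpa [h] using M.edge_vert hv
        simp [this]
    · rintro rfl
      exact ⟨fun v hv => by simp at hv, by simp⟩
  simp [matchingPolynomialOn, this]

theorem matchingPolynomialOn_univ [Fintype V] (G : SimpleGraph V) :
    G.matchingPolynomialOn Finset.univ = G.matchingPolynomial := by
  classical
  have hle : ∀ M ∈ G.matchingsOn Finset.univ,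
      M.edgeSet.ncard ∈ Finset.range (Fintype.card V / 2 + 1) := by
    intro M hM
    have h1 := (mem_matchingsOn.1 hM).1.two_mul_ncard_edgeSet
    have h2 : M.verts.ncard ≤ Fintype.card V := by
      rw [← Nat.card_eq_fintype_card, ← Set.ncard_univ]
      exact Set.ncard_le_ncard (Set.subset_univ _)
    rw [Finset.mem_range]
    omega
  rw [matchingPolynomialOn, matchingPolynomial, ← Finset.sum_fiberwise_of_maps_to hle]
  refine Finset.sum_congr rfl fun k _ => ?_
  have hc : G.matchingCount k =
      ((G.matchingsOn Finset.univ).filter fun M => M.edgeSet.ncard = k).card := by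
    rw [matchingCount, ← Set.ncard_coe_finset]
    congr 1
    ext M
    simp
  rw [hc, Finset.sum_congr rfl (g := fun _ => (-1) ^ k * X ^ (Fintype.card V - 2 * k))]
  · simp
    ring
  · intro M hM
    obtain ⟨hM', hk⟩ := Finset.mem_filter.1 hM
    rw [← hk, (mem_matchingsOn.1 hM').1.two_mul_ncard_edgeSet, Finset.card_univ]

section

variable {G : SimpleGraph V} {v u : V}

theorem Subgraph.IsMatching.deleteVerts_pair {M : G.Subgraph} (hM : M.IsMatching)
    (h : M.Adj v u) : (M.deleteVerts {v, u}).IsMatching := by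
  intro x hx
  simp only [Subgraph.deleteVerts_verts, Set.mem_sdiff, Set.mem_insert_iff,
    Set.mem_singleton_iff, not_or] at hx
  obtain ⟨y, hy, huniq⟩ := hM hx.1
  refine ⟨y, ?_, fun z hz => huniq z (Subgraph.deleteVerts_le.2 hz)⟩
  have h1 : y ≠ v := fun e => hx.2.2 (hM.eq_of_adj_left (e ▸ hy.symm) h)
  have h2 : y ≠ u := fun e => hx.2.1 (hM.eq_of_adj_left (e ▸ hy.symm) h.symm)
  simp only [Subgraph.deleteVerts_adj, Set.mem_insert_iff, Set.mem_singleton_iff, not_or]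
  exact ⟨hx.1, hx.2, M.edge_vert hy.symm, ⟨h1, h2⟩, hy⟩

theorem Subgraph.IsMatching.sup_subgraphOfAdj {M : G.Subgraph} (hM : M.IsMatching)
    (h : G.Adj v u) (hv : v ∉ M.verts) (hu : u ∉ M.verts) :
    (M ⊔ G.subgraphOfAdj h).IsMatching := by
  refine hM.sup (.subgraphOfAdj h) ?_
  rw [hM.support_eq_verts, (IsMatching.subgraphOfAdj h).support_eq_verts]
  simp [hv, hu]

theorem Subgraph.deleteVerts_pair_sup_subgraphOfAdj {M : G.Subgraph} (hM : M.IsMatching)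
    (h : G.Adj v u) (hvu : M.Adj v u) : M.deleteVerts {v, u} ⊔ G.subgraphOfAdj h = M := by
  refine le_antisymm (sup_le deleteVerts_le (subgraphOfAdj_le_of_adj _ hvu)) ⟨?_, ?_⟩
  · intro x hx
    simp
    tauto
  · intro x y hxy
    by_cases hx : x = v ∨ x = u
    · rcases hx with rfl | rfl
      · obtain rfl := hM.eq_of_adj_left hvu hxy
        simp
      · obtain rfl := hM.eq_of_adj_left hvu.symm hxy
        simp [Sym2.eq_swap]
    by_cases hy : y = v ∨ y = u
    · rcases hy with rfl | rfl
      · obtain rfl := hM.eq_of_adj_left hvu hxy.symm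
        simp [Sym2.eq_swap]
      · obtain rfl := hM.eq_of_adj_left hvu.symm hxy.symm
        simp
    have := M.edge_vert hxy
    have := M.edge_vert hxy.symm
    simp
    tauto

theorem Subgraph.sup_subgraphOfAdj_deleteVerts_pair {M : G.Subgraph} (h : G.Adj v u)
    (hv : v ∉ M.verts) (hu : u ∉ M.verts) :
    (M ⊔ G.subgraphOfAdj h).deleteVerts {v, u} = M := by
  ext x y
  · have h1 : x ∈ M.verts → x ≠ v := fun h e => hv (e ▸ h)
    have h2 : x ∈ M.verts → x ≠ u := fun h e => hu (e ▸ h)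
    simp
    tauto
  · constructor
    · simp
      rintro - h1 h2 - h3 h4 (h5 | h5)
      · exact h5
      · grind
    · intro hxy
      have hx := M.edge_vert hxy
      have hy := M.edge_vert hxy.symm
      have h1 : x ≠ v := fun e => hv (e ▸ hx)
      have h2 : x ≠ u := fun e => hu (e ▸ hx)
      have h3 : y ≠ v := fun e => hv (e ▸ hy)
      have h4 : y ≠ u := fun e => hu (e ▸ hy)
      simp [*]

end

/-- Split the matchings by whether they cover v. Those that do are sorted by the partner u of v, and
removing the edge vu is a bijection onto the matchings inside `S.erase u`. -/
theorem matchingPolynomialOn_insert [Finite V] [DecidableEq V] (G : SimpleGraph V)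
    [DecidableRel G.Adj] {v : V} {S : Finset V} (hv : v ∉ S) :
    G.matchingPolynomialOn (insert v S) = X * G.matchingPolynomialOn S -
      ∑ u ∈ S with G.Adj v u, G.matchingPolynomialOn (S.erase u) := by
  classical
  have hcard : ∀ M : G.Subgraph, M.verts ⊆ S → M.verts.ncard ≤ S.card := fun M hM => by
    rw [← Set.ncard_coe_finset]
    exact Set.ncard_le_ncard hM
  have h1 : (G.matchingsOn (insert v S)).filter (fun M => v ∉ M.verts) = G.matchingsOn S := by
    ext M
    simp only [Finset.mem_filter, mem_matchingsOn, Finset.coe_insert, and_assoc]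
    refine and_congr_right fun _ => ⟨fun h => ?_, fun h => ⟨h.trans (Set.subset_insert _ _),
      fun hm => hv (h hm)⟩⟩
    exact (Set.subset_insert_iff_of_notMem h.2).1 h.1
  have h2 : ∀ f : G.Subgraph → ℤ[X],
      ∑ M ∈ G.matchingsOn (insert v S) with v ∈ M.verts, f M =
        ∑ u ∈ S with G.Adj v u, ∑ M ∈ G.matchingsOn (insert v S) with M.Adj v u, f M := by
    intro f
    simp only [Finset.sum_filter (fun M : G.Subgraph => v ∈ M.verts),
      Finset.sum_filter (fun M : G.Subgraph => M.Adj v _)]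
    rw [Finset.sum_comm]
    refine Finset.sum_congr rfl fun M hM => ?_
    obtain ⟨hM, hS⟩ := mem_matchingsOn.1 hM
    split_ifs with hvM
    · obtain ⟨u, hu, huniq⟩ := hM hvM
      have huS : u ∈ S := by
        have := hS (M.edge_vert hu.symm)
        rw [Finset.coe_insert] at this
        exact this.resolve_left hu.adj_sub.ne'
      rw [Finset.sum_eq_single u]
      · rw [if_pos hu]
      · intro w _ hw
        exact if_neg fun h => hw (huniq w h)
      · intro h
        exact absurd (Finset.mem_filter.2 ⟨huS, hu.adj_sub⟩) h
    · symm
      refine Finset.sum_eq_zero fun u _ => if_neg fun h => hvM (M.edge_vert h)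
  rw [matchingPolynomialOn,
    ← Finset.sum_filter_not_add_sum_filter _ (fun M : G.Subgraph => v ∈ M.verts), h1, h2,
    sub_eq_add_neg, ← Finset.sum_neg_distrib, matchingPolynomialOn, Finset.mul_sum]
  congr 1
  · refine Finset.sum_congr rfl fun M hM => ?_
    have := hcard M (mem_matchingsOn.1 hM).2
    rw [Finset.card_insert_of_notMem hv, Nat.sub_add_comm this]
    ring
  · refine Finset.sum_congr rfl fun u hu => ?_
    obtain ⟨huS, hadj⟩ := Finset.mem_filter.1 hu
    have hvu : v ≠ u := hadj.ne
    rw [matchingPolynomialOn, ← Finset.sum_neg_distrib]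
    have hout : ∀ M ∈ G.matchingsOn (S.erase u), v ∉ M.verts ∧ u ∉ M.verts := by
      intro M hM
      have := (mem_matchingsOn.1 hM).2
      exact ⟨fun h => hv (Finset.mem_of_mem_erase (this h)),
        fun h => Finset.notMem_erase u S (this h)⟩
    symm
    refine Finset.sum_nbij' (fun M => M ⊔ G.subgraphOfAdj hadj) (fun M => M.deleteVerts {v, u})
      ?_ ?_ ?_ ?_ ?_
    · intro M hM
      obtain ⟨hv', hu'⟩ := hout M hM
      obtain ⟨hM, hMS⟩ := mem_matchingsOn.1 hM
      refine Finset.mem_filter.2 ⟨mem_matchingsOn.2 ⟨hM.sup_subgraphOfAdj hadj hv' hu', ?_⟩, ?_⟩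
      · intro x hx
        simp only [Subgraph.verts_sup, subgraphOfAdj_verts, Set.mem_union, Set.mem_insert_iff,
          Set.mem_singleton_iff] at hx
        rw [Finset.mem_coe, Finset.mem_insert]
        rcases hx with hx | rfl | rfl
        · exact .inr (Finset.mem_of_mem_erase (hMS hx))
        · exact .inl rfl
        · exact .inr huS
      · simp
    · intro M hM
      obtain ⟨hM, hMvu⟩ := Finset.mem_filter.1 hM
      obtain ⟨hM, hMS⟩ := mem_matchingsOn.1 hM
      refine mem_matchingsOn.2 ⟨hM.deleteVerts_pair hMvu, ?_⟩
      intro x hx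
      have := @hMS x
      simp at hx this ⊢
      tauto
    · intro M hM
      obtain ⟨hv', hu'⟩ := hout M hM
      exact Subgraph.sup_subgraphOfAdj_deleteVerts_pair hadj hv' hu'
    · intro M hM
      obtain ⟨hM, hMvu⟩ := Finset.mem_filter.1 hM
      exact Subgraph.deleteVerts_pair_sup_subgraphOfAdj (mem_matchingsOn.1 hM).1 hadj hMvu
    · intro M hM
      obtain ⟨hv', hu'⟩ := hout M hM
      obtain ⟨hM, hMS⟩ := mem_matchingsOn.1 hM
      have hM2 := hM.sup_subgraphOfAdj hadj hv' hu'
      have e1 := hM.two_mul_ncard_edgeSet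
      have e2 := hM2.two_mul_ncard_edgeSet
      have e3 : (M ⊔ G.subgraphOfAdj hadj).verts.ncard = M.verts.ncard + 2 := by
        rw [Subgraph.verts_sup, subgraphOfAdj_verts, Set.ncard_union_eq, Set.ncard_pair hvu]
        simp [hv', hu']
      have e4 : (M ⊔ G.subgraphOfAdj hadj).edgeSet.ncard = M.edgeSet.ncard + 1 := by omega
      -- Both sides are truncated subtractions; they agree because `S` contains u and so has
      -- positive cardinality.
      have e5 : (insert v S).card - (M.verts.ncard + 2) = (S.erase u).card - M.verts.ncard := by
        have := Finset.card_pos.2 ⟨u, huS⟩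
        rw [Finset.card_insert_of_notMem hv, Finset.card_erase_of_mem huS]
        omega
      rw [e3, e4, e5]
      ring

/-- Induction on |S|: differentiate the recurrence at one vertex v and apply the recurrence again to
each term with another vertex deleted. -/
theorem derivative_matchingPolynomialOn [Finite V] [DecidableEq V] (G : SimpleGraph V)
    (S : Finset V) :
    derivative (G.matchingPolynomialOn S) = ∑ v ∈ S, G.matchingPolynomialOn (S.erase v) := by
  classical
  induction hn : S.card using Nat.strong_induction_on generalizing S with
  | _ n ih =>
  rcases S.eq_empty_or_nonempty with rfl | ⟨v, hvS⟩
  · simp [matchingPolynomialOn_empty]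
  obtain ⟨T, hvT, rfl⟩ : ∃ T, v ∉ T ∧ insert v T = S :=
    ⟨S.erase v, Finset.notMem_erase _ _, Finset.insert_erase hvS⟩
  rw [Finset.card_insert_of_notMem hvT] at hn
  have hT := ih T.card (by omega) T rfl
  have hE : ∀ u ∈ T, derivative (G.matchingPolynomialOn (T.erase u)) =
      ∑ w ∈ T.erase u, G.matchingPolynomialOn ((T.erase u).erase w) := fun u hu =>
    ih _ (by rw [Finset.card_erase_of_mem hu]; omega) _ rfl
  have hI : ∀ w ∈ T, G.matchingPolynomialOn ((insert v T).erase w) =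
      X * G.matchingPolynomialOn (T.erase w) -
        ∑ u ∈ T.erase w with G.Adj v u, G.matchingPolynomialOn ((T.erase w).erase u) := by
    intro w hw
    rw [Finset.erase_insert_of_ne (by rintro rfl; exact hvT hw),
      matchingPolynomialOn_insert G (fun h => hvT (Finset.mem_of_mem_erase h))]
  rw [matchingPolynomialOn_insert G hvT, Finset.sum_insert hvT, Finset.erase_insert hvT,
    Finset.sum_congr rfl hI, Finset.sum_sub_distrib, ← Finset.mul_sum, derivative_sub,
    derivative_mul, derivative_X, one_mul, hT, derivative_sum,
    Finset.sum_congr rfl fun u hu => hE u (Finset.mem_of_mem_filter u hu), add_sub_assoc]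
  congr 2
  -- Both double sums run over pairs of distinct u, w in `T` with u adjacent to v, and the two
  -- deletions commute.
  rw [Finset.sum_comm' (t' := T) (s' := fun w => (T.erase w).filter fun u => G.Adj v u)]
  · refine Finset.sum_congr rfl fun w _ => Finset.sum_congr rfl fun u _ => ?_
    rw [Finset.erase_right_comm]
  · intro u w
    simp only [Finset.mem_filter, Finset.mem_erase]
    tauto

end SimpleGraph

/-! ### Continued fraction for the ratios, location of the zeros, contraction -/

namespace SimpleGraph

variable {V : Type*} [Finite V] [DecidableEq V] (G : SimpleGraph V)

/-- The ratio `μ(G[S] - v, z) / μ(G[S], z)`. -/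
noncomputable def matchingRatio (S : Finset V) (z : ℂ) (v : V) : ℂ :=
  aeval z (G.matchingPolynomialOn (S.erase v)) / aeval z (G.matchingPolynomialOn S)

variable {G} {S : Finset V} {z : ℂ} {v : V}

theorem aeval_matchingPolynomialOn [DecidableRel G.Adj] (hv : v ∈ S)
    (h : aeval z (G.matchingPolynomialOn (S.erase v)) ≠ 0) :
    aeval z (G.matchingPolynomialOn S) = aeval z (G.matchingPolynomialOn (S.erase v)) *
      (z - ∑ u ∈ S.erase v with G.Adj v u, G.matchingRatio (S.erase v) z u) := by
  conv_lhs => rw [← Finset.insert_erase hv, matchingPolynomialOn_insert G (Finset.notMem_erase v S)]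
  simp only [map_sub, map_mul, aeval_X, map_sum, mul_sub, Finset.mul_sum, matchingRatio]
  congr 1
  · ring
  · exact Finset.sum_congr rfl fun u _ => by field_simp

theorem matchingRatio_eq_inv [DecidableRel G.Adj] (hv : v ∈ S)
    (h : aeval z (G.matchingPolynomialOn (S.erase v)) ≠ 0) :
    G.matchingRatio S z v =
      (z - ∑ u ∈ S.erase v with G.Adj v u, G.matchingRatio (S.erase v) z u)⁻¹ := by
  rw [matchingRatio, aeval_matchingPolynomialOn hv h, div_mul_cancel_left₀ h]

/-- Both claims must be proved together: ratios with nonpositive imaginary part keep the denominator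
of the continued fraction in the upper half plane, so it is nonzero and its inverse again has
nonpositive imaginary part. -/
theorem matchingPolynomialOn_ne_zero_of_im_pos (hz : 0 < z.im) (S : Finset V) :
    aeval z (G.matchingPolynomialOn S) ≠ 0 ∧ ∀ v ∈ S, (G.matchingRatio S z v).im ≤ 0 := by
  classical
  induction hn : S.card using Nat.strong_induction_on generalizing S with
  | _ n ih =>
  have key : ∀ v ∈ S, aeval z (G.matchingPolynomialOn (S.erase v)) ≠ 0 ∧
      0 < (z - ∑ u ∈ S.erase v with G.Adj v u, G.matchingRatio (S.erase v) z u).im := by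
    intro v hv
    obtain ⟨h1, h2⟩ := ih _ (hn ▸ Finset.card_erase_lt_of_mem hv) (S.erase v) rfl
    refine ⟨h1, ?_⟩
    rw [Complex.sub_im, Complex.im_sum]
    have := Finset.sum_nonpos fun u (hu : u ∈ (S.erase v).filter fun u => G.Adj v u) =>
      h2 u (Finset.mem_of_mem_filter u hu)
    linarith
  constructor
  · rcases S.eq_empty_or_nonempty with rfl | ⟨v, hv⟩
    · simp [matchingPolynomialOn_empty]
    · obtain ⟨h1, h2⟩ := key v hv
      rw [aeval_matchingPolynomialOn hv h1]
      exact mul_ne_zero h1 fun h => by simp [h] at h2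
  · intro v hv
    obtain ⟨h1, h2⟩ := key v hv
    rw [matchingRatio_eq_inv hv h1, Complex.inv_im]
    exact div_nonpos_of_nonpos_of_nonneg (by linarith) (Complex.normSq_nonneg _)

/-- If the previous ratios are at most 1/a, their sum is at most |S|/a, which leaves a denominator
of norm at least a. The choice a = √n minimises a + n/a and yields the root bound 2√n. -/
theorem matchingPolynomialOn_ne_zero_of_le_norm {a : ℝ} (ha : 0 < a) (S : Finset V)
    (hz : a + S.card / a ≤ ‖z‖) :
    aeval z (G.matchingPolynomialOn S) ≠ 0 ∧ ∀ v ∈ S, ‖G.matchingRatio S z v‖ ≤ a⁻¹ := by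
  classical
  induction hn : S.card using Nat.strong_induction_on generalizing S with
  | _ n ih =>
  have key : ∀ v ∈ S, aeval z (G.matchingPolynomialOn (S.erase v)) ≠ 0 ∧
      a ≤ ‖z - ∑ u ∈ S.erase v with G.Adj v u, G.matchingRatio (S.erase v) z u‖ := by
    intro v hv
    have hc := Finset.card_erase_lt_of_mem hv
    have hc' : ((S.erase v).card : ℝ) ≤ S.card := by exact_mod_cast hc.le
    obtain ⟨h1, h2⟩ := ih _ (hn ▸ hc) (S.erase v) (le_trans (by gcongr) hz) rfl
    refine ⟨h1, ?_⟩
    have h3 : ‖∑ u ∈ S.erase v with G.Adj v u, G.matchingRatio (S.erase v) z u‖ ≤ S.card / a := by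
      refine (norm_sum_le _ _).trans ((Finset.sum_le_card_nsmul _ _ a⁻¹ fun u hu =>
        h2 u (Finset.mem_of_mem_filter u hu)).trans ?_)
      rw [nsmul_eq_mul, div_eq_mul_inv]
      have : (((S.erase v).filter fun u => G.Adj v u).card : ℝ) ≤ (S.erase v).card := by
        exact_mod_cast Finset.card_filter_le _ _
      exact mul_le_mul_of_nonneg_right (this.trans hc') (by positivity)
    have := norm_sub_norm_le z (∑ u ∈ S.erase v with G.Adj v u, G.matchingRatio (S.erase v) z u)
    linarith
  constructor
  · rcases S.eq_empty_or_nonempty with rfl | ⟨v, hv⟩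
    · simp [matchingPolynomialOn_empty]
    · obtain ⟨h1, h2⟩ := key v hv
      rw [aeval_matchingPolynomialOn hv h1]
      exact mul_ne_zero h1 (norm_pos_iff.1 (ha.trans_le h2))
  · intro v hv
    obtain ⟨h1, h2⟩ := key v hv
    rw [matchingRatio_eq_inv hv h1, norm_inv]
    exact inv_anti₀ ha h2

theorem aeval_conj_eq_zero {q : ℤ[X]} (h : aeval z q = 0) :
    aeval ((starRingEnd ℂ) z) q = 0 := by
  have := aeval_algHom_apply (starRingEnd ℂ).toIntAlgHom z q
  rw [h, map_zero] at this
  exact this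

/-- **Heilmann–Lieb theorem**: the matching polynomial has only real roots. -/
theorem im_eq_zero_of_aeval_matchingPolynomial_eq_zero {V : Type*} [Fintype V]
    {G : SimpleGraph V} {z : ℂ} (h : aeval z G.matchingPolynomial = 0) : z.im = 0 := by
  classical
  rw [← matchingPolynomialOn_univ] at h
  rcases lt_trichotomy z.im 0 with hz | hz | hz
  · exact absurd (aeval_conj_eq_zero h)
      (matchingPolynomialOn_ne_zero_of_im_pos (by simpa using hz) _).1
  · exact hz
  · exact absurd h (matchingPolynomialOn_ne_zero_of_im_pos hz _).1

theorem norm_le_of_aeval_matchingPolynomial_eq_zero {V : Type*} [Fintype V] [Nonempty V]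
    {G : SimpleGraph V} {z : ℂ} (h : aeval z G.matchingPolynomial = 0) :
    ‖z‖ ≤ 2 * √(Fintype.card V) := by
  classical
  rw [← matchingPolynomialOn_univ] at h
  by_contra! hz
  have hpos : (0 : ℝ) < Fintype.card V := by exact_mod_cast Fintype.card_pos
  refine (matchingPolynomialOn_ne_zero_of_le_norm (Real.sqrt_pos.2 hpos) _ ?_).1 h
  rw [Finset.card_univ, Real.div_sqrt]
  linarith

/-- Both sides are the logarithmic derivative μ'/μ at z. -/
theorem sum_matchingRatio {V : Type*} [Fintype V] [DecidableEq V] {G : SimpleGraph V} {z : ℂ}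
    (h : aeval z G.matchingPolynomial ≠ 0) :
    ((G.matchingPolynomial.aroots ℂ).map fun θ => 1 / (z - θ)).sum =
      ∑ v, G.matchingRatio Finset.univ z v := by
  have hs := IsAlgClosed.splits (G.matchingPolynomial.map (algebraMap ℤ ℂ))
  rw [aeval_def, ← eval_map] at h
  rw [aroots, ← hs.eval_derivative_div_eval_of_ne_zero h, derivative_map]
  simp only [matchingRatio, ← Finset.sum_div, ← map_sum]
  rw [← derivative_matchingPolynomialOn, matchingPolynomialOn_univ]
  simp only [aeval_def, eval_map]

/-- Here `K` counts the remaining unrollings of the recursion, each of which deletes one more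
vertex; `L` bounds the total number of deletions, hence the change in any degree. The number r is a
fixed point of x ↦ 1/(w − p·x). -/
theorem norm_matchingRatio_sub_le {V : Type*} [Fintype V] [DecidableEq V] {G : SimpleGraph V}
    [DecidableRel G.Adj] {p r ε : ℝ} {L : ℕ}
    (hp : 0 ≤ p) (hr : 0 < r) (hr3 : r ≤ 1 / 3)
    (hdeg : ∀ v, |(G.degree v : ℝ) - p * Fintype.card V| ≤ ε * Fintype.card V) (K : ℕ) :
    ∀ S : Finset V, Sᶜ.card + K ≤ L → ∀ v ∈ S,
      ‖√(Fintype.card V) * G.matchingRatio S (√(Fintype.card V) * (1 / r + p * r) : ℝ) v - r‖ ≤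
        (ε + L / Fintype.card V) + (1 / 4) ^ K := by
  intro S hS v hv
  set N : ℝ := ((Fintype.card V : ℕ) : ℝ) with hN
  have hN0 : 0 < N := by
    rw [hN]; exact_mod_cast Fintype.card_pos_iff.2 ⟨v⟩
  have hε : 0 ≤ ε := by
    have := (abs_nonneg _).trans (hdeg v)
    exact nonneg_of_mul_nonneg_left this hN0
  have hsq : 0 < √N := Real.sqrt_pos.2 hN0
  set w : ℝ := 1 / r + p * r with hw
  have hw3 : 3 ≤ w := by
    have : 3 ≤ 1 / r := by rw [le_div_iff₀ hr]; linarith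
    have : 0 ≤ p * r := by positivity
    linarith
  have hsqN : √N * √N = N := Real.mul_self_sqrt hN0.le
  have bound : ∀ T : Finset V, aeval ((√N * w : ℝ) : ℂ) (G.matchingPolynomialOn T) ≠ 0 ∧
      ∀ v ∈ T, ‖√N * G.matchingRatio T (√N * w : ℝ) v‖ ≤ 1 / 2 := by
    intro T
    -- With a = 2√N the requirement is at most (5/2)√N, below 3√N ≤ w√N; the resulting bound 1/a
    -- becomes 1/2 after scaling.
    have hle : (2 * √N) + T.card / (2 * √N) ≤ ‖((√N * w : ℝ) : ℂ)‖ := by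
      have hT : (T.card : ℝ) ≤ N := by rw [hN]; exact_mod_cast Finset.card_le_univ T
      have h1 : T.card / (2 * √N) ≤ √N := by
        rw [div_le_iff₀ (by positivity)]
        nlinarith
      rw [Complex.norm_real, Real.norm_of_nonneg (by positivity)]
      nlinarith
    obtain ⟨h1, h2⟩ := matchingPolynomialOn_ne_zero_of_le_norm (G := G) (by positivity) T hle
    refine ⟨h1, fun v hv => ?_⟩
    rw [norm_mul, Complex.norm_real, Real.norm_of_nonneg hsq.le]
    refine (mul_le_mul_of_nonneg_left (h2 v hv) hsq.le).trans (le_of_eq ?_)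
    field_simp
  induction K generalizing S v with
  | zero =>
    refine (norm_sub_le _ _).trans ?_
    have h1 := (bound S).2 v hv
    have h2 : ‖(r : ℂ)‖ ≤ 1 / 2 := by
      rw [Complex.norm_real, Real.norm_of_nonneg hr.le]; linarith
    have : 0 ≤ ε + L / N := by positivity
    rw [pow_zero]
    linarith
  | succ K ih =>
    set D := (S.erase v).filter fun u => G.Adj v u with hD
    set g : V → ℂ := fun u => √N * G.matchingRatio (S.erase v) (√N * w : ℝ) u with hg
    set x : ℂ := √N * G.matchingRatio S (√N * w : ℝ) v with hx
    have hcompl : (S.erase v)ᶜ.card = Sᶜ.card + 1 := by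
      rw [Finset.compl_erase, Finset.card_insert_of_notMem (by simpa using hv)]
    have hgu : ∀ u ∈ D, ‖g u - r‖ ≤ (ε + L / N) + (1 / 4) ^ K := fun u hu =>
      ih (S.erase v) (by omega) u (Finset.mem_of_mem_filter u hu)
    have hxe : x * (w - (∑ u ∈ D, g u) / N) = 1 := by
      have h1 := (bound (S.erase v)).1
      have h2 := matchingRatio_eq_inv hv h1
      have h3 := (bound S).1
      have h4 := aeval_matchingPolynomialOn hv h1
      have h5 := right_ne_zero_of_mul (h4 ▸ h3)
      have hsc : (√N : ℂ) ≠ 0 := by exact_mod_cast hsq.ne'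
      have hNc : (N : ℂ) = √N * √N := by exact_mod_cast hsqN.symm
      rw [hx, h2, hg, ← Finset.mul_sum, hNc]
      rw [← hD] at h5 ⊢
      push_cast at h5 ⊢
      field_simp
    -- Difference of the inverses of two denominators; the factor |x|·r ≤ 1/6 is the contraction.
    have hxr : x - r = x * r * ((∑ u ∈ D, g u) / N - p * r) := by
      have hrw : (r : ℂ) * (w - p * r) = 1 := by
        have : r * (w - p * r) = 1 := by rw [hw]; field_simp; ring
        exact_mod_cast this
      linear_combination (x : ℂ) * (-hrw) + r * hxe
    have hDc : |(D.card : ℝ) - p * N| ≤ ε * N + L := by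
      have e1 : D.card ≤ G.degree v := by
        rw [← card_neighborFinset_eq_degree]
        refine Finset.card_le_card fun u hu => ?_
        simpa using (Finset.mem_filter.1 hu).2
      have e2 : G.degree v ≤ D.card + L := by
        rw [← card_neighborFinset_eq_degree]
        refine (Finset.card_le_card (t := D ∪ (S.erase v)ᶜ) fun u hu => ?_).trans
          ((Finset.card_union_le _ _).trans (by omega))
        rw [mem_neighborFinset] at hu
        rw [Finset.mem_union, Finset.mem_compl, hD, Finset.mem_filter]
        tauto
      have e1' : (D.card : ℝ) ≤ G.degree v := by exact_mod_cast e1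
      have e2' : (G.degree v : ℝ) ≤ D.card + L := by exact_mod_cast e2
      have e3 := abs_le.1 (hdeg v)
      have : (0 : ℝ) ≤ L := by positivity
      rw [abs_le]
      constructor <;> linarith
    have hDN : (D.card : ℝ) ≤ N := by rw [hN]; exact_mod_cast Finset.card_le_univ D
    have hsum : ‖(∑ u ∈ D, g u) / N - p * r‖ ≤
        ((ε + L / N) + (1 / 4) ^ K) + (ε + L / N) * (1 / 3) := by
      have hNc : (N : ℂ) ≠ 0 := by exact_mod_cast hN0.ne'
      have e1 : (∑ u ∈ D, g u) / N - p * r =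
          (∑ u ∈ D, (g u - r)) / N + (((D.card : ℝ) - p * N) / N * r : ℝ) := by
        rw [Finset.sum_sub_distrib]
        push_cast
        simp only [Finset.sum_const, nsmul_eq_mul]
        field_simp
        ring
      rw [e1]
      refine (norm_add_le _ _).trans (add_le_add ?_ ?_)
      · rw [norm_div, Complex.norm_real, Real.norm_of_nonneg hN0.le, div_le_iff₀ hN0]
        refine (norm_sum_le _ _).trans ((Finset.sum_le_card_nsmul _ _ _ hgu).trans ?_)
        rw [nsmul_eq_mul, mul_comm]
        gcongr
      · rw [Complex.norm_real, Real.norm_eq_abs, abs_mul, abs_div, abs_of_pos hN0, abs_of_pos hr]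
        gcongr
        rw [div_le_iff₀ hN0, add_mul, div_mul_cancel₀ _ hN0.ne']
        exact hDc
    rw [hxr, norm_mul, norm_mul, Complex.norm_real, Real.norm_of_nonneg hr.le]
    have hx2 := (bound S).2 v hv
    have h0 : 0 ≤ ε + L / N := by positivity
    have h4 : (0 : ℝ) < (1 / 4) ^ K := by positivity
    calc ‖x‖ * r * ‖(∑ u ∈ D, g u) / N - p * r‖
        ≤ 1 / 2 * (1 / 3) * (((ε + L / N) + (1 / 4) ^ K) + (ε + L / N) * (1 / 3)) := by gcongr
      _ ≤ (ε + L / N) + (1 / 4) ^ (K + 1) := by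
        rw [pow_succ]
        linarith

end SimpleGraph

/-! ### Generating function of the orthogonal polynomials and a convergence criterion -/

/-- The monic orthogonal polynomials of the semicircle law of variance `p`. -/
noncomputable def semicirclePoly (p : ℝ) : ℕ → ℝ[X]
  | 0 => 1
  | 1 => X
  | k + 2 => X * semicirclePoly p (k + 1) - C p * semicirclePoly p k

theorem semicirclePoly_monic_natDegree (p : ℝ) (k : ℕ) :
    (semicirclePoly p k).Monic ∧ (semicirclePoly p k).natDegree = k := by
  induction k using Nat.strong_induction_on with
  | _ k ih =>
  match k with
  | 0 => simp [semicirclePoly]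
  | 1 => simp [semicirclePoly]
  | k + 2 =>
    obtain ⟨h1, h2⟩ := ih (k + 1) (by omega)
    obtain ⟨-, h4⟩ := ih k (by omega)
    have hX : (X * semicirclePoly p (k + 1)).Monic := monic_X.mul h1
    have hXd : (X * semicirclePoly p (k + 1)).natDegree = k + 2 := by
      rw [monic_X.natDegree_mul h1, natDegree_X, h2]
      ring
    have hd : (C p * semicirclePoly p k).natDegree ≤ k := (natDegree_C_mul_le _ _).trans h4.le
    have hlt : (C p * semicirclePoly p k).degree < (X * semicirclePoly p (k + 1)).degree := by
      refine degree_lt_degree ?_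
      rw [hXd]
      omega
    rw [semicirclePoly]
    exact ⟨hX.sub_of_left hlt, by rw [natDegree_sub_eq_left_of_natDegree_lt (by omega), hXd]⟩

/-- The recurrence allows growth rate c as soon as 2c + 1 ≤ c², and c = 3 will do. -/
theorem abs_eval_semicirclePoly_le {p x : ℝ} (hp : 0 ≤ p) (hp1 : p ≤ 1) (hx : |x| ≤ 2) (k : ℕ) :
    |(semicirclePoly p k).eval x| ≤ 3 ^ k := by
  induction k using Nat.strong_induction_on with
  | _ k ih =>
  match k with
  | 0 => simp [semicirclePoly]
  | 1 => simp [semicirclePoly]; linarith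
  | k + 2 =>
    have h1 := ih (k + 1) (by omega)
    have h2 := ih k (by omega)
    have h3 : (0 : ℝ) < 3 ^ k := by positivity
    simp only [semicirclePoly, eval_sub, eval_mul, eval_X, eval_C]
    calc _ ≤ |x| * |(semicirclePoly p (k + 1)).eval x| + p * |(semicirclePoly p k).eval x| := by
          refine (abs_sub _ _).trans (le_of_eq ?_)
          rw [abs_mul, abs_mul, abs_of_nonneg hp]
      _ ≤ 2 * 3 ^ (k + 1) + 1 * 3 ^ k := by gcongr
      _ ≤ 3 ^ (k + 2) := by
        rw [pow_succ _ (k + 1), pow_succ]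
        linarith

theorem sum_semicirclePoly (p x r : ℝ) (N : ℕ) :
    (1 - x * r + p * r ^ 2) * ∑ k ∈ Finset.range (N + 1), (semicirclePoly p k).eval x * r ^ k =
      1 - r ^ (N + 1) * (semicirclePoly p (N + 1)).eval x +
        p * r ^ (N + 2) * (semicirclePoly p N).eval x := by
  induction N with
  | zero => simp [semicirclePoly]; ring
  | succ N ih =>
    rw [Finset.sum_range_succ, mul_add, ih]
    simp only [semicirclePoly, eval_sub, eval_mul, eval_X, eval_C]
    ring

theorem abs_inv_sub_sum_semicirclePoly_le {p x r : ℝ} (hp : 0 ≤ p) (hp1 : p ≤ 1) (hx : |x| ≤ 2)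
    (hr : 0 < r) (hr3 : r ≤ 1 / 3) (N : ℕ) :
    |(1 - x * r + p * r ^ 2)⁻¹ - ∑ k ∈ Finset.range (N + 1), (semicirclePoly p k).eval x * r ^ k| ≤
      3 ^ (N + 3) * r ^ (N + 1) := by
  have hd : 1 / 3 ≤ 1 - x * r + p * r ^ 2 := by
    have : 0 ≤ p * r ^ 2 := by positivity
    nlinarith [(abs_le.1 hx).2]
  have hd0 : 0 < 1 - x * r + p * r ^ 2 := by linarith
  have h1 := abs_eval_semicirclePoly_le hp hp1 hx (N + 1)
  have h2 := abs_eval_semicirclePoly_le hp hp1 hx N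
  have key : (1 - x * r + p * r ^ 2)⁻¹ -
      ∑ k ∈ Finset.range (N + 1), (semicirclePoly p k).eval x * r ^ k =
      (r ^ (N + 1) * (semicirclePoly p (N + 1)).eval x -
        p * r ^ (N + 2) * (semicirclePoly p N).eval x) * (1 - x * r + p * r ^ 2)⁻¹ := by
    rw [eq_mul_inv_iff_mul_eq₀ hd0.ne', sub_mul, inv_mul_cancel₀ hd0.ne']
    linear_combination -sum_semicirclePoly p x r N
  have hrN : 0 < r ^ (N + 1) := by positivity
  rw [key, abs_mul]
  calc _ ≤ (r ^ (N + 1) * 3 ^ (N + 1) + 1 * (r ^ (N + 1) * 1) * 3 ^ N) * 3 := by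
        gcongr ?_ * ?_
        · refine (abs_sub _ _).trans ?_
          rw [abs_mul, abs_mul, abs_mul, abs_of_pos hrN, abs_of_nonneg hp,
            abs_of_pos (by positivity : 0 < r ^ (N + 2)), pow_succ r (N + 1)]
          gcongr
          linarith
        · rw [abs_inv, abs_of_pos hd0]
          exact inv_le_of_inv_le₀ (by norm_num) (by linarith)
    _ ≤ 3 ^ (N + 3) * r ^ (N + 1) := by
        have h3 : (0 : ℝ) < r ^ (N + 1) * 3 ^ N := by positivity
        have e1 : (3 : ℝ) ^ (N + 1) = 3 ^ N * 3 := by ring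
        have e2 : (3 : ℝ) ^ (N + 3) = 3 ^ N * 27 := by ring
        rw [e1, e2]
        linarith

theorem integrable_of_ae_abs_le_two {ν : Measure ℝ} [IsFiniteMeasure ν] (hν : ∀ᵐ x ∂ν, |x| ≤ 2)
    {f : ℝ → ℝ} (hf : Continuous f) : Integrable f ν := by
  obtain ⟨B, hB⟩ := (isCompact_Icc (a := (-2 : ℝ)) (b := 2)).exists_bound_of_continuousOn
    hf.continuousOn
  refine Integrable.of_bound hf.aestronglyMeasurable B ?_
  filter_upwards [hν] with x hx using hB x (abs_le.1 hx)

theorem abs_integral_le_of_abs_le_two {ν : Measure ℝ} [IsProbabilityMeasure ν]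
    (hν : ∀ᵐ x ∂ν, |x| ≤ 2) {f : ℝ → ℝ} {B : ℝ} (hf : ∀ x, |x| ≤ 2 → |f x| ≤ B) :
    |∫ x, f x ∂ν| ≤ B := by
  have := norm_integral_le_of_norm_le_const (μ := ν) (f := f) (C := B)
    (by filter_upwards [hν] with x hx using hf x hx)
  simpa using this

section

variable {ι : Type*} {l : Filter ι} {ν : ι → Measure ℝ} [∀ i, IsProbabilityMeasure (ν i)] {p : ℝ}

/-- Strong induction on the coefficient: for fixed r the earlier terms of the expansion vanish in
the limit and the tail is O(r^(k+2)), so dividing by r^(k+1) leaves an error O(r), with r arbitrary.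
-/
theorem tendsto_integral_semicirclePoly (hp : 0 ≤ p) (hp1 : p ≤ 1)
    (hν : ∀ i, ∀ᵐ x ∂ν i, |x| ≤ 2)
    (h : ∀ r : ℝ, 0 < r → r ≤ 1 / 3 →
      Tendsto (fun i => ∫ x, (1 - x * r + p * r ^ 2)⁻¹ ∂ν i) l (𝓝 1)) (k : ℕ) :
    Tendsto (fun i => ∫ x, (semicirclePoly p (k + 1)).eval x ∂ν i) l (𝓝 0) := by
  induction k using Nat.strong_induction_on with
  | _ k ih =>
  rw [Metric.tendsto_nhds]
  intro ε hε
  -- The tail constant 3^(N+3) for N = k + 1. The tail and the vanishing earlier terms each get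
  -- C·r^(k+2), whence 2·C·r < ε.
  set C : ℝ := 3 ^ (k + 4) with hC
  have hC0 : 0 < C := by positivity
  obtain ⟨r, hr, hr3, hrε⟩ : ∃ r : ℝ, 0 < r ∧ r ≤ 1 / 3 ∧ 2 * C * r < ε := by
    refine ⟨min (1 / 3) (ε / (4 * C)), by positivity, min_le_left _ _, ?_⟩
    have := min_le_right (1 / 3) (ε / (4 * C))
    calc _ ≤ 2 * C * (ε / (4 * C)) := by gcongr
      _ = ε / 2 := by field_simp; norm_num
      _ < ε := by linarith
  have hlow : Tendsto (fun i => (∫ x, (1 - x * r + p * r ^ 2)⁻¹ ∂ν i) - 1 -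
      ∑ j ∈ Finset.range k, (∫ x, (semicirclePoly p (j + 1)).eval x ∂ν i) * r ^ (j + 1)) l
      (𝓝 (1 - 1 - ∑ j ∈ Finset.range k, 0 * r ^ (j + 1))) :=
    ((h r hr hr3).sub_const 1).sub (tendsto_finsetSum _ fun j hj =>
      (ih j (Finset.mem_range.1 hj)).mul_const _)
  simp only [sub_self, zero_mul, Finset.sum_const_zero] at hlow
  filter_upwards [(Metric.tendsto_nhds.1 hlow) (C * r ^ (k + 2)) (by positivity)] with i hi
  rw [Real.dist_eq, sub_zero] at hi ⊢
  have hint : ∀ j, Integrable (fun x => (semicirclePoly p j).eval x * r ^ j) (ν i) := fun j =>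
    integrable_of_ae_abs_le_two (hν i) (by fun_prop)
  have hinv : Integrable (fun x => (1 - x * r + p * r ^ 2)⁻¹) (ν i) := by
    refine Integrable.of_bound (by fun_prop) 3 ?_
    filter_upwards [hν i] with x hx
    have hd : 1 / 3 ≤ 1 - x * r + p * r ^ 2 := by
      have : 0 ≤ p * r ^ 2 := by positivity
      nlinarith [(abs_le.1 hx).2]
    rw [norm_inv, Real.norm_of_nonneg (by linarith)]
    exact inv_le_of_inv_le₀ (by norm_num) (by linarith)
  have herr := abs_integral_le_of_abs_le_two (hν i) fun x hx =>
    abs_inv_sub_sum_semicirclePoly_le hp hp1 hx hr hr3 (k + 1)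
  rw [integral_sub hinv (integrable_finsetSum _ fun j _ => hint j),
    integral_finsetSum _ fun j _ => hint j] at herr
  simp only [integral_mul_const] at herr
  rw [Finset.sum_range_succ, Finset.sum_range_succ'] at herr
  simp only [semicirclePoly, eval_one, integral_const, probReal_univ, smul_eq_mul, mul_one,
    pow_zero] at herr
  have e : |(∫ x, (semicirclePoly p (k + 1)).eval x ∂ν i)| * r ^ (k + 1) ≤
      2 * C * r * r ^ (k + 1) := by
    rw [← abs_of_pos (pow_pos hr (k + 1)), ← abs_mul, abs_of_pos (pow_pos hr (k + 1))]
    rw [abs_le] at herr ⊢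
    rw [abs_lt] at hi
    rw [hC] at *
    have : r * r ^ (k + 1) = r ^ (k + 2) := by ring
    rw [mul_assoc, this]
    have e4 : (3 : ℝ) ^ (k + 1 + 3) = 3 ^ (k + 4) := by ring
    rw [e4] at herr
    constructor <;> linarith
  exact (le_of_mul_le_mul_right e (by positivity)).trans_lt hrε

theorem tendsto_integral_poly {ν' : Measure ℝ} [IsProbabilityMeasure ν']
    (hν : ∀ i, ∀ᵐ x ∂ν i, |x| ≤ 2) (hν' : ∀ᵐ x ∂ν', |x| ≤ 2)
    (h : ∀ k, Tendsto (fun i => ∫ x, (semicirclePoly p k).eval x ∂ν i) l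
      (𝓝 (∫ x, (semicirclePoly p k).eval x ∂ν'))) (q : ℝ[X]) :
    Tendsto (fun i => ∫ x, q.eval x ∂ν i) l (𝓝 (∫ x, q.eval x ∂ν')) := by
  induction hn : q.natDegree using Nat.strong_induction_on generalizing q with
  | _ n ih =>
  obtain ⟨h1, h2⟩ := semicirclePoly_monic_natDegree p n
  set q' := q - C q.leadingCoeff * semicirclePoly p n with hq'
  have hq : ∀ (μ : Measure ℝ) [IsProbabilityMeasure μ], (∀ᵐ x ∂μ, |x| ≤ 2) →
      ∫ x, q.eval x ∂μ = ∫ x, q'.eval x ∂μ +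
        q.leadingCoeff * ∫ x, (semicirclePoly p n).eval x ∂μ := by
    intro μ _ hμ
    rw [← integral_const_mul, ← integral_add
      (integrable_of_ae_abs_le_two hμ (by fun_prop)) (integrable_of_ae_abs_le_two hμ (by fun_prop))]
    simp [hq']
  simp_rw [fun i => hq (ν i) (hν i), hq ν' hν']
  refine Tendsto.add ?_ ((h n).const_mul _)
  rcases Nat.eq_zero_or_pos n with rfl | hn0
  · have : q' = 0 := by
      rw [hq', eq_C_of_natDegree_eq_zero hn]
      simp [semicirclePoly]
    simpa [this] using tendsto_const_nhds
  · refine ih _ ?_ q' rfl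
    have hle : q'.natDegree ≤ n := (natDegree_sub_le_of_le hn.le
      ((natDegree_C_mul_le _ _).trans h2.le)).trans (by simp)
    refine lt_of_le_of_ne hle fun he => ?_
    have hc : q'.coeff n = 0 := by
      have h3 : (semicirclePoly p n).coeff n = 1 := by
        rw [Monic, leadingCoeff, h2] at h1
        exact h1
      rw [hq', coeff_sub, coeff_C_mul, h3, leadingCoeff, hn]
      ring
    have : q' = 0 := by
      rw [← leadingCoeff_eq_zero, leadingCoeff, he, hc]
    rw [this, natDegree_zero] at he
    omega

theorem tendsto_integral_of_tendsto_integral_poly {ν' : Measure ℝ} [IsProbabilityMeasure ν']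
    (hν : ∀ i, ∀ᵐ x ∂ν i, |x| ≤ 2) (hν' : ∀ᵐ x ∂ν', |x| ≤ 2)
    (h : ∀ q : ℝ[X], Tendsto (fun i => ∫ x, q.eval x ∂ν i) l (𝓝 (∫ x, q.eval x ∂ν')))
    {f : ℝ → ℝ} (hf : Continuous f) :
    Tendsto (fun i => ∫ x, f x ∂ν i) l (𝓝 (∫ x, f x ∂ν')) := by
  rw [Metric.tendsto_nhds]
  intro ε hε
  obtain ⟨q, hq⟩ := exists_polynomial_near_of_continuousOn (-2) 2 f hf.continuousOn (ε / 3)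
    (by positivity)
  have hap : ∀ (μ : Measure ℝ) [IsProbabilityMeasure μ], (∀ᵐ x ∂μ, |x| ≤ 2) →
      |∫ x, q.eval x ∂μ - ∫ x, f x ∂μ| ≤ ε / 3 := by
    intro μ _ hμ
    rw [← integral_sub (integrable_of_ae_abs_le_two hμ (by fun_prop))
      (integrable_of_ae_abs_le_two hμ hf)]
    exact abs_integral_le_of_abs_le_two hμ fun x hx => (hq x (abs_le.1 hx)).le
  filter_upwards [(Metric.tendsto_nhds.1 (h q)) (ε / 3) (by positivity)] with i hi
  rw [Real.dist_eq] at hi ⊢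
  have h1 := abs_le.1 (hap (ν i) (hν i))
  have h2 := abs_le.1 (hap ν' hν')
  rw [abs_lt] at hi ⊢
  constructor <;> linarith

end

/-! ### Integrals against the semicircle law via x = 2√p cos θ -/

theorem eval_semicirclePoly_mul_sin {p : ℝ} (hp : 0 ≤ p) (k : ℕ) (θ : ℝ) :
    (semicirclePoly p k).eval (2 * √p * Real.cos θ) * Real.sin θ =
      √p ^ k * Real.sin ((k + 1) * θ) := by
  induction k using Nat.strong_induction_on with
  | _ k ih =>
  match k with
  | 0 => simp [semicirclePoly]
  | 1 =>
    have : ((1 : ℕ) + 1 : ℝ) * θ = 2 * θ := by norm_num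
    rw [this, Real.sin_two_mul]
    simp [semicirclePoly]
    ring
  | k + 2 =>
    have h1 := ih (k + 1) (by omega)
    have h2 := ih k (by omega)
    have hs : p = √p * √p := (Real.mul_self_sqrt hp).symm
    simp only [semicirclePoly, eval_sub, eval_mul, eval_X, eval_C]
    have e1 : ((k + 2 : ℕ) + 1 : ℝ) * θ = ((k + 1 : ℕ) + 1 : ℝ) * θ + θ := by push_cast; ring
    have e2 : ((k : ℕ) + 1 : ℝ) * θ = ((k + 1 : ℕ) + 1 : ℝ) * θ - θ := by push_cast; ring
    rw [e2] at h2
    rw [e1]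
    set A := ((k + 1 : ℕ) + 1 : ℝ) * θ
    have e3 : Real.sin (A + θ) + Real.sin (A - θ) = 2 * Real.sin A * Real.cos θ := by
      rw [Real.sin_add, Real.sin_sub]; ring
    have e4 : √p ^ (k + 2) * (Real.sin (A + θ) + Real.sin (A - θ)) =
      √p ^ (k + 2) * (2 * Real.sin A * Real.cos θ) := by rw [e3]
    have e5 : p * (√p ^ k * Real.sin (A - θ)) = √p ^ (k + 2) * Real.sin (A - θ) := by
      conv_lhs => rw [hs]
      rw [Real.sqrt_mul_self (Real.sqrt_nonneg p)]
      ring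
    linear_combination (2 * √p * Real.cos θ) * h1 - p * h2 - e4 - e5

theorem integral_sin_mul_sin_eq_zero (k : ℕ) :
    ∫ θ in (0 : ℝ)..Real.pi, Real.sin ((k + 2) * θ) * Real.sin θ = 0 := by
  have hk : (0 : ℝ) < k + 1 := by positivity
  have hk' : (0 : ℝ) < k + 3 := by positivity
  have hderiv : ∀ θ ∈ Set.uIcc 0 Real.pi, HasDerivAt (fun θ : ℝ =>
      Real.sin ((k + 1) * θ) / (2 * (k + 1)) - Real.sin ((k + 3) * θ) / (2 * (k + 3)))
      (Real.sin ((k + 2) * θ) * Real.sin θ) θ := by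
    intro θ _
    have h1 := ((Real.hasDerivAt_sin (((k : ℝ) + 1) * θ)).comp θ
      ((hasDerivAt_id θ).const_mul ((k : ℝ) + 1))).div_const (2 * ((k : ℝ) + 1))
    have h2 := ((Real.hasDerivAt_sin (((k : ℝ) + 3) * θ)).comp θ
      ((hasDerivAt_id θ).const_mul ((k : ℝ) + 3))).div_const (2 * ((k : ℝ) + 3))
    refine (h1.sub h2).congr_deriv ?_
    have e1 : ((k : ℝ) + 1) * θ = (k + 2) * θ - θ := by ring
    have e3 : ((k : ℝ) + 3) * θ = (k + 2) * θ + θ := by ring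
    rw [e1, e3, Real.cos_sub, Real.cos_add]
    field_simp
    ring
  rw [intervalIntegral.integral_eq_sub_of_hasDerivAt hderiv
    (Continuous.intervalIntegrable (by fun_prop) _ _)]
  have h1 : Real.sin (((k : ℝ) + 1) * Real.pi) = 0 := by
    exact_mod_cast Real.sin_nat_mul_pi (k + 1)
  have h3 : Real.sin (((k : ℝ) + 3) * Real.pi) = 0 := by
    exact_mod_cast Real.sin_nat_mul_pi (k + 3)
  simp [h1, h3]

theorem integral_semicircleReal {p : ℝ} (hp : 0 < p) (f : ℝ → ℝ) :
    ∫ x, f x ∂(semicircleReal p hp : Measure ℝ) = ∫ x in (-2 * √p)..(2 * √p),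
      1 / (2 * Real.pi * √p) * √(4 - x ^ 2 / p) * f x := by
  have hs : 0 < √p := Real.sqrt_pos.2 hp
  have hm : Measurable (semicirclePDF p) :=
    Measurable.indicator (by fun_prop) measurableSet_Icc
  rw [intervalIntegral.integral_of_le (by linarith), ← integral_Icc_eq_integral_Ioc,
    ← integral_indicator measurableSet_Icc]
  change ∫ x, f x ∂(volume.withDensity fun x => ENNReal.ofReal (semicirclePDF p x)) = _
  rw [integral_withDensity_eq_integral_toReal_smul (by fun_prop) (by simp)]
  congr 1
  ext x
  rw [ENNReal.toReal_ofReal (semicirclePDF_nonneg p x), semicirclePDF, smul_eq_mul]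
  by_cases hx : x ∈ Set.Icc (-2 * √p) (2 * √p)
  · rw [Set.indicator_of_mem hx, Set.indicator_of_mem hx]
  · rw [Set.indicator_of_notMem hx, Set.indicator_of_notMem hx, zero_mul]

theorem integral_semicirclePoly {p : ℝ} (hp : 0 < p) (k : ℕ) :
    ∫ x, (semicirclePoly p (k + 1)).eval x ∂(semicircleReal p hp : Measure ℝ) = 0 := by
  have hs : 0 < √p := Real.sqrt_pos.2 hp
  rw [integral_semicircleReal hp]
  have hsub := intervalIntegral.integral_comp_mul_deriv (a := Real.pi) (b := 0)
    (f := fun θ => 2 * √p * Real.cos θ) (f' := fun θ => 2 * √p * -Real.sin θ)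
    (g := fun x => 1 / (2 * Real.pi * √p) * √(4 - x ^ 2 / p) *
      (semicirclePoly p (k + 1)).eval x)
    (fun θ _ => (Real.hasDerivAt_cos θ).const_mul _) (by fun_prop) (by fun_prop)
  simp only [Real.cos_pi, Real.cos_zero, mul_one] at hsub
  have e0 : 2 * √p * -1 = -2 * √p := by ring
  rw [e0] at hsub
  rw [← hsub, intervalIntegral.integral_symm, neg_eq_zero]
  have hcongr : ∀ θ ∈ Set.uIcc 0 Real.pi,
      ((fun x => 1 / (2 * Real.pi * √p) * √(4 - x ^ 2 / p) * (semicirclePoly p (k + 1)).eval x) ∘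
        fun θ => 2 * √p * Real.cos θ) θ * (2 * √p * -Real.sin θ) =
      (-2 / Real.pi * √p ^ (k + 1)) * (Real.sin ((k + 2) * θ) * Real.sin θ) := by
    intro θ hθ
    rw [Set.uIcc_of_le Real.pi_pos.le] at hθ
    have hsin := Real.sin_nonneg_of_mem_Icc hθ
    have h1 : √(4 - (2 * √p * Real.cos θ) ^ 2 / p) = 2 * Real.sin θ := by
      rw [show 4 - (2 * √p * Real.cos θ) ^ 2 / p = (2 * Real.sin θ) ^ 2 by
        rw [mul_pow, mul_pow, Real.sq_sqrt hp.le, mul_pow, Real.sin_sq]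
        field_simp
        ring]
      exact Real.sqrt_sq (by linarith)
    have h2 := eval_semicirclePoly_mul_sin hp.le (k + 1) θ
    have h3 : ((k + 1 : ℕ) + 1 : ℝ) * θ = (k + 2) * θ := by push_cast; ring
    rw [h3] at h2
    simp only [Function.comp_apply, h1]
    have hpi := Real.pi_pos
    have : 1 / (2 * Real.pi * √p) * (2 * √p) = 1 / Real.pi := by field_simp
    linear_combination (-2 / Real.pi * Real.sin θ) * h2 + (-2 * Real.sin θ *
      (eval (2 * √p * Real.cos θ) (semicirclePoly p (k + 1))) * Real.sin θ) * this
  rw [intervalIntegral.integral_congr hcongr, intervalIntegral.integral_const_mul,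
    integral_sin_mul_sin_eq_zero, mul_zero]

theorem ae_abs_le_two_semicircleReal {p : ℝ} (hp : 0 < p) (hp1 : p ≤ 1) :
    ∀ᵐ x ∂(semicircleReal p hp : Measure ℝ), |x| ≤ 2 := by
  have hm : Measurable (semicirclePDF p) :=
    Measurable.indicator (by fun_prop) measurableSet_Icc
  change ∀ᵐ x ∂(volume.withDensity fun x => ENNReal.ofReal (semicirclePDF p x)), |x| ≤ 2
  rw [ae_withDensity_iff (by fun_prop)]
  refine ae_of_all _ fun x hx => ?_
  have hx' : x ∈ Set.Icc (-2 * √p) (2 * √p) := by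
    by_contra h
    exact hx (by rw [semicirclePDF, Set.indicator_of_notMem h, ENNReal.ofReal_zero])
  have : √p ≤ 1 := Real.sqrt_le_one.2 hp1
  rw [abs_le]
  constructor <;> linarith [hx'.1, hx'.2]

theorem tendsto_semicircleReal {ι : Type*} {l : Filter ι} {ν : ι → ProbabilityMeasure ℝ} {p : ℝ}
    (hp : 0 < p) (hp1 : p ≤ 1) (hν : ∀ i, ∀ᵐ x ∂(ν i : Measure ℝ), |x| ≤ 2)
    (h : ∀ r : ℝ, 0 < r → r ≤ 1 / 3 →
      Tendsto (fun i => ∫ x, (1 - x * r + p * r ^ 2)⁻¹ ∂(ν i : Measure ℝ)) l (𝓝 1)) :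
    Tendsto ν l (𝓝 (semicircleReal p hp)) := by
  rw [ProbabilityMeasure.tendsto_iff_forall_integral_tendsto]
  intro f
  refine tendsto_integral_of_tendsto_integral_poly hν (ae_abs_le_two_semicircleReal hp hp1)
    (tendsto_integral_poly (p := p) hν (ae_abs_le_two_semicircleReal hp hp1) ?_) f.continuous
  rintro (_ | k)
  · simpa [semicirclePoly] using tendsto_const_nhds
  · rw [integral_semicirclePoly hp]
    exact tendsto_integral_semicirclePoly hp.le hp1 hν h k

/-! ### Concentration of the degrees -/

namespace SimpleGraph

open Measure unitInterval

/-- Exhibits the edge indicators as independent coordinates of a product measure, those on the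
diagonal being forced to `False`. -/
theorem binomialRandom_eq_map_infinitePi (V : Type*) [Countable V] (p : I) :
    binomialRandom V p = Measure.map (fun q : Sym2 V → Prop => fromEdgeSet {e | q e})
      (infinitePi fun e : Sym2 V =>
        toNNReal p • dirac (e ∈ (Sym2.diagSetᶜ : Set (Sym2 V))) + toNNReal (σ p) • dirac False) := by
  rw [binomialRandom_eq_map, setBernoulli_eq_map, Measure.map_map measurable_fromEdgeSet]
  · rfl
  · exact MeasurableEquiv.setOfPred.measurable

theorem measurableSet_of_finite {V : Type*} [Finite V] (A : Set (SimpleGraph V)) :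
    MeasurableSet A :=
  measurableEmbedding_edgeSet.measurableSet_image.1 (Set.toFinite _).measurableSet

open scoped Classical in
-- Hoeffding's inequality: each centred indicator takes values in an interval of length 1, so it is
-- sub-Gaussian with parameter (1/2)²; the factor 2 accounts for the two tails.
theorem measureReal_le_abs_sum_bernoulli {ι : Type*} (u : Set ι) (p : I) {s : Finset ι}
    (hs : ∀ i ∈ s, i ∈ u) {t : ℝ} (ht : 0 ≤ t) :
    (infinitePi fun i : ι => toNNReal p • dirac (i ∈ u) + toNNReal (σ p) • dirac False).real
      {q | t ≤ |∑ i ∈ s, ((if q i then 1 else 0) - (p : ℝ))|} ≤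
      2 * Real.exp (-2 * t ^ 2 / s.card) := by
  set μ := infinitePi fun i : ι => toNNReal p • dirac (i ∈ u) + toNNReal (σ p) • dirac False
    with hμ
  have hmeas : Measurable fun b : Prop => (if b then (1 : ℝ) else 0) - (p : ℝ) := .of_discrete
  have hind : iIndepFun (fun (i : ι) (q : ι → Prop) => (if q i then (1 : ℝ) else 0) - (p : ℝ)) μ :=
    iIndepFun_infinitePi fun _ => hmeas
  have hsub : ∀ i ∈ s, HasSubgaussianMGF
      (fun q : ι → Prop => (if q i then (1 : ℝ) else 0) - (p : ℝ)) ((1 / 2) ^ 2) μ := by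
    intro i hi
    have h1 := hasSubgaussianMGF_of_mem_Icc_of_integral_eq_zero (μ := μ)
      (X := fun q : ι → Prop => (if q i then (1 : ℝ) else 0) - (p : ℝ))
      (a := -(p : ℝ)) (b := 1 - p) (hmeas.comp (measurable_pi_apply i)).aemeasurable
      (ae_of_all _ fun q => by
        have := p.2.1
        by_cases h : q i <;> simp [h]) ?_
    · simpa using h1
    · have h2 : ∫ q, ((if q i then (1 : ℝ) else 0) - (p : ℝ)) ∂μ =
          ∫ b, ((if b then (1 : ℝ) else 0) - (p : ℝ)) ∂(μ.map fun q => q i) :=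
        (integral_map (φ := fun q : ι → Prop => q i) (measurable_pi_apply i).aemeasurable
          hmeas.aestronglyMeasurable).symm
      rw [h2, hμ, infinitePi_map_eval, integral_add_measure (.of_finite) (.of_finite),
        integral_smul_nnreal_measure, integral_smul_nnreal_measure, integral_dirac, integral_dirac]
      simp [hs i hi, NNReal.smul_def]
      ring
  have hbound : ∀ X : ι → (ι → Prop) → ℝ, iIndepFun X μ →
      (∀ i ∈ s, HasSubgaussianMGF (X i) ((1 / 2) ^ 2) μ) →
      μ.real {q | t ≤ ∑ i ∈ s, X i q} ≤ Real.exp (-2 * t ^ 2 / s.card) := by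
    intro X hX hXs
    refine (HasSubgaussianMGF.measure_sum_ge_le_of_iIndepFun hX hXs ht).trans (le_of_eq ?_)
    congr 1
    simp
    ring
  have hpos := hbound _ hind hsub
  have hneg := hbound (fun i q => -((if q i then (1 : ℝ) else 0) - (p : ℝ)))
    (hind.comp (fun _ x => -x) fun _ => measurable_neg) fun i hi => (hsub i hi).neg
  calc _ ≤ μ.real ({q | t ≤ ∑ i ∈ s, ((if q i then (1 : ℝ) else 0) - (p : ℝ))} ∪
        {q | t ≤ ∑ i ∈ s, -((if q i then (1 : ℝ) else 0) - (p : ℝ))}) := by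
        refine measureReal_mono fun q hq => ?_
        rw [Set.mem_union, Set.mem_ofPred, Set.mem_ofPred, Finset.sum_neg_distrib]
        exact le_abs.1 hq
    _ ≤ _ := (measureReal_union_le _ _).trans (by linarith)

open scoped Classical in
theorem binomialRandom_real_le_abs_degree_sub {V : Type*} [Fintype V] [Nontrivial V] (p : I) (v : V)
    {t : ℝ} (ht : 0 ≤ t) :
    (binomialRandom V p).real {G | t ≤ |(G.degree v : ℝ) - p * (Fintype.card V - 1)|} ≤
      2 * Real.exp (-2 * t ^ 2 / Fintype.card V) := by
  set s : Finset (Sym2 V) := (Finset.univ.erase v).image fun u => s(v, u) with hs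
  have hinj : Function.Injective fun u => s(v, u) := fun a b h => Sym2.congr_right.1 h
  have hV : 1 < Fintype.card V := Fintype.one_lt_card
  have hcard : (s.card : ℝ) = Fintype.card V - 1 := by
    rw [hs, Finset.card_image_of_injective _ hinj, Finset.card_erase_of_mem (Finset.mem_univ v),
      Finset.card_univ, Nat.cast_sub hV.le, Nat.cast_one]
  have hsu : ∀ e ∈ s, e ∈ (Sym2.diagSetᶜ : Set (Sym2 V)) := by
    intro e he
    obtain ⟨u, hu, rfl⟩ := Finset.mem_image.1 he
    simpa using (Finset.ne_of_mem_erase hu).symm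
  have hdeg : ∀ q : Sym2 V → Prop, ((fromEdgeSet {e | q e}).degree v : ℝ) -
      p * (Fintype.card V - 1) = ∑ e ∈ s, ((if q e then 1 else 0) - (p : ℝ)) := by
    intro q
    rw [Finset.sum_sub_distrib, Finset.sum_const, nsmul_eq_mul, hcard, mul_comm]
    congr 1
    rw [hs, Finset.sum_image (hinj.injOn), ← Finset.sum_filter, Finset.sum_const, nsmul_eq_mul,
      mul_one, ← card_neighborFinset_eq_degree]
    congr 2
    ext u
    simp [and_comm, eq_comm]
  have hm : Measurable fun q : Sym2 V → Prop => fromEdgeSet {e | q e} :=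
    measurable_fromEdgeSet.comp MeasurableEquiv.setOfPred.measurable
  rw [binomialRandom_eq_map_infinitePi, map_measureReal_apply hm (measurableSet_of_finite _)]
  have := measureReal_le_abs_sum_bernoulli (Sym2.diagSetᶜ : Set (Sym2 V)) p hsu ht
  have hset : (fun q : Sym2 V → Prop => fromEdgeSet {e | q e}) ⁻¹'
      {G | t ≤ |(G.degree v : ℝ) - p * (Fintype.card V - 1)|} =
      {q | t ≤ |∑ e ∈ s, ((if q e then 1 else 0) - (p : ℝ))|} := by
    ext q
    rw [Set.mem_preimage, Set.mem_ofPred, Set.mem_ofPred, ← hdeg]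
    congr!
  rw [hset]
  refine this.trans ?_
  rw [hcard]
  have h1 : (1 : ℝ) < Fintype.card V := by exact_mod_cast hV
  have h2 : 2 * t ^ 2 / Fintype.card V ≤ 2 * t ^ 2 / (Fintype.card V - 1) :=
    div_le_div_of_nonneg_left (by positivity) (by linarith) (by linarith)
  gcongr 2 * Real.exp ?_
  rw [neg_mul, neg_div, neg_div]
  linarith

open scoped Classical in
theorem ae_eventually_abs_degree_sub_le {Ω : Type*} [MeasurableSpace Ω] {P : Measure Ω}
    [IsProbabilityMeasure P] {p : I} {G : (n : ℕ+) → Ω → SimpleGraph (Fin n)}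
    (hG : ∀ n : ℕ+, HasLaw (G n) (binomialRandom (Fin n) p) P) {ε : ℝ} (hε : 0 < ε) :
    ∀ᵐ ω ∂P, ∀ᶠ n : ℕ+ in atTop, ∀ v, |((G n ω).degree v : ℝ) - p * n| ≤ ε * n := by
  -- Start at two vertices, where the vertex type is nontrivial.
  set N : ℕ → ℕ+ := fun k => (k + 1).succPNat with hN
  have hNk : ∀ k, ((N k : ℕ) : ℝ) = k + 2 := fun k => by
    simp [hN]
    ring
  set A : ℕ → Set Ω := fun k =>
    ⋃ v, G (N k) ⁻¹' {H | ε / 2 * N k ≤ |(H.degree v : ℝ) - p * (N k - 1)|} with hA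
  have hbound : ∀ k, P (A k) ≤
      ENNReal.ofReal (2 * (((k + 2 : ℕ) : ℝ) ^ 1 * Real.exp (-(ε ^ 2 / 2) * (k + 2 : ℕ)))) := by
    intro k
    have : Nontrivial (Fin (N k)) := Fin.nontrivial_iff_two_le.2 (by simp [hN])
    have hpos : (0 : ℝ) < N k := by exact_mod_cast (N k).pos
    rw [← ofReal_measureReal]
    refine ENNReal.ofReal_le_ofReal ((measureReal_iUnion_fintype_le _).trans ?_)
    have h1 : ∀ v, P.real (G (N k) ⁻¹' {H | ε / 2 * N k ≤ |(H.degree v : ℝ) - p * (N k - 1)|}) ≤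
        2 * Real.exp (-(ε ^ 2 / 2) * N k) := by
      intro v
      rw [← map_measureReal_apply_of_aemeasurable (hG (N k)).aemeasurable
        (measurableSet_of_finite _), (hG (N k)).map_eq]
      have := binomialRandom_real_le_abs_degree_sub p v (t := ε / 2 * N k) (by positivity)
      rw [Fintype.card_fin] at this
      refine this.trans (le_of_eq ?_)
      congr 2
      field_simp
    refine (Finset.sum_le_card_nsmul _ _ _ fun v _ => h1 v).trans (le_of_eq ?_)
    rw [Finset.card_univ, Fintype.card_fin, nsmul_eq_mul, hNk]
    push_cast
    ring
  have hsum : ∑' k, P (A k) ≠ ⊤ := by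
    refine ne_top_of_le_ne_top ?_ (ENNReal.tsum_le_tsum hbound)
    exact (((summable_nat_add_iff 2).2
      (Real.summable_pow_mul_exp_neg_nat_mul 1 (by positivity))).mul_left 2).tsum_ofReal_ne_top
  filter_upwards [ae_eventually_notMem hsum] with ω hω
  obtain ⟨K, hK⟩ := eventually_atTop.1 hω
  -- The mean degree is p(n − 1), not pn: half of ε pays for the fluctuation, the other half absorbs
  -- p once n ≥ 2p/ε.
  obtain ⟨M, hM⟩ := exists_nat_ge (2 * p / ε : ℝ)
  filter_upwards [eventually_ge_atTop (N (max K M))] with n hn v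
  obtain ⟨k, rfl⟩ : ∃ k, N k = n := by
    have : (2 : ℕ) ≤ n := le_trans (by simp [hN]) (PNat.coe_le_coe _ _ |>.2 hn)
    refine ⟨n - 2, PNat.eq ?_⟩
    simp [hN]
    omega
  have hk : max K M ≤ k := by
    have := PNat.coe_le_coe _ _ |>.2 hn
    simpa [hN] using this
  have hnot := hK k ((le_max_left _ _).trans hk)
  simp only [hA, Set.mem_iUnion, Set.mem_preimage, Set.mem_ofPred_eq, not_exists, not_le] at hnot
  have h1 := abs_lt.1 (hnot v)
  have hp0 := p.2.1
  have h2 : (p : ℝ) ≤ ε / 2 * N k := by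
    have : (M : ℝ) ≤ N k := by
      rw [hNk]
      have : (M : ℝ) ≤ k := by exact_mod_cast (le_max_right _ _).trans hk
      linarith
    have := hM.trans this
    rw [div_le_iff₀ hε] at this
    linarith
  rw [abs_le]
  constructor <;> linarith

end SimpleGraph

/-! ### The root measure on the real line and its Stieltjes transform -/

theorem PMF.integral_toMeasure_ofMultiset {α : Type*} [MeasurableSpace α]
    [MeasurableSingletonClass α] {s : Multiset α} (hs : s ≠ 0) (f : α → ℝ) :
    ∫ x, f x ∂(PMF.ofMultiset s hs).toMeasure = (s.map f).sum / s.card := by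
  classical
  have hf : Integrable f (PMF.ofMultiset s hs).toMeasure := by
    rw [← PMF.restrict_toMeasure_support]
    exact IntegrableOn.of_finite (by simp)
  rw [PMF.integral_eq_tsum _ _ hf, tsum_eq_sum (s := s.toFinset)]
  · rw [Finset.sum_multiset_map_count, Finset.sum_div]
    refine Finset.sum_congr rfl fun x _ => ?_
    simp [ENNReal.toReal_div]
    ring
  · intro x hx
    rw [PMF.ofMultiset_apply_of_notMem hs (by simpa using hx)]
    simp

theorem PMF.ae_mem_toMeasure_ofMultiset {α : Type*} [MeasurableSpace α]
    [MeasurableSingletonClass α] {s : Multiset α} (hs : s ≠ 0) :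
    ∀ᵐ x ∂(PMF.ofMultiset s hs).toMeasure, x ∈ s := by
  classical
  rw [← PMF.restrict_toMeasure_support, PMF.support_ofMultiset]
  filter_upwards [ae_restrict_mem s.toFinset.measurableSet] with x hx
  simpa using hx

namespace SimpleGraph

variable {V : Type*} [Fintype V] (G : SimpleGraph V)

theorem card_aroots_matchingPolynomial :
    (G.matchingPolynomial.aroots ℂ).card = Fintype.card V := by
  have hle : G.matchingPolynomial.natDegree ≤ Fintype.card V := by
    rw [matchingPolynomial]
    refine natDegree_sum_le_of_forall_le _ _ fun k _ => (natDegree_C_mul_X_pow_le _ _).trans ?_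
    omega
  have hc := G.coeff_matchingPolynomial_card
  have heq : G.matchingPolynomial.natDegree = Fintype.card V :=
    le_antisymm hle (le_natDegree_of_ne_zero (by simp [hc]))
  rw [aroots, ← (IsAlgClosed.splits _).natDegree_eq_card_roots,
    natDegree_map_eq_of_injective (algebraMap ℤ ℂ).injective_int, heq]

variable [Nonempty V]

theorem coe_scaledMatchingMeasure : (G.scaledMatchingMeasure : Measure ℂ) =
    (PMF.ofMultiset (G.matchingPolynomial.aroots ℂ)
      G.aroots_matchingPolynomial_ne_zero).toMeasure.map
        fun z : ℂ => z / (Real.sqrt (Fintype.card V) : ℂ) := rfl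

theorem ae_scaledMatchingMeasure :
    ∀ᵐ z ∂(G.scaledMatchingMeasure : Measure ℂ), (z.re : ℂ) = z ∧ |z.re| ≤ 2 := by
  have hn : (0 : ℝ) < √(Fintype.card V) := Real.sqrt_pos.2 (by exact_mod_cast Fintype.card_pos)
  have hms : MeasurableSet {z : ℂ | (z.re : ℂ) = z ∧ |z.re| ≤ 2} :=
    (measurableSet_eq_fun (f := fun z : ℂ => (z.re : ℂ)) (by fun_prop) measurable_id).inter
      (measurableSet_le (f := fun z : ℂ => |z.re|) (by fun_prop) measurable_const)
  rw [coe_scaledMatchingMeasure, ae_map_iff (by fun_prop) hms]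
  filter_upwards [PMF.ae_mem_toMeasure_ofMultiset G.aroots_matchingPolynomial_ne_zero] with z hz
  have h0 := (mem_aroots'.1 hz).2
  have him := im_eq_zero_of_aeval_matchingPolynomial_eq_zero h0
  have hnorm := norm_le_of_aeval_matchingPolynomial_eq_zero h0
  constructor
  · apply Complex.ext <;> simp [Complex.div_ofReal_im, him]
  · rw [Complex.div_ofReal_re, abs_div, abs_of_pos hn, div_le_iff₀ hn]
    exact (Complex.abs_re_le_norm z).trans hnorm

/-- The scaled matching measure as a measure on the real line. -/
noncomputable def scaledMatchingMeasureReal : ProbabilityMeasure ℝ :=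
  G.scaledMatchingMeasure.map (f := Complex.re) (by fun_prop)

/-- The roots are real, so taking real parts loses nothing and convergence may be proved on ℝ. -/
theorem map_ofReal_scaledMatchingMeasureReal :
    G.scaledMatchingMeasureReal.map (f := fun x : ℝ => (x : ℂ)) (by fun_prop) =
      G.scaledMatchingMeasure := by
  refine Subtype.ext ?_
  change ((G.scaledMatchingMeasure : Measure ℂ).map Complex.re).map (fun x : ℝ => (x : ℂ)) =
    (G.scaledMatchingMeasure : Measure ℂ)
  rw [Measure.map_map (by fun_prop) (by fun_prop)]
  refine (Measure.map_congr ?_).trans Measure.map_id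
  filter_upwards [G.ae_scaledMatchingMeasure] with z hz using hz.1

theorem ae_abs_le_two_scaledMatchingMeasureReal :
    ∀ᵐ x ∂(G.scaledMatchingMeasureReal : Measure ℝ), |x| ≤ 2 := by
  change ∀ᵐ x ∂(G.scaledMatchingMeasure : Measure ℂ).map Complex.re, |x| ≤ 2
  rw [ae_map_iff (by fun_prop) (measurableSet_le (by fun_prop) measurable_const)]
  filter_upwards [G.ae_scaledMatchingMeasure] with z hz using hz.2

theorem integral_scaledMatchingMeasureReal {f : ℝ → ℝ} (hf : Measurable f) :
    ∫ x, f x ∂(G.scaledMatchingMeasureReal : Measure ℝ) =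
      ((G.matchingPolynomial.aroots ℂ).map fun z => f (z.re / √(Fintype.card V))).sum /
        Fintype.card V := by
  change ∫ x, f x ∂(G.scaledMatchingMeasure : Measure ℂ).map Complex.re = _
  rw [integral_map (by fun_prop) hf.aestronglyMeasurable, coe_scaledMatchingMeasure,
    integral_map (f := fun z : ℂ => f z.re) (by fun_prop)
      (hf.comp Complex.measurable_re).aestronglyMeasurable,
    PMF.integral_toMeasure_ofMultiset, card_aroots_matchingPolynomial]
  simp only [Complex.div_ofReal_re]

/-- With x = θ/√n and z = √n·w, (1 − xr + pr²)⁻¹ = r⁻¹√n / (z − θ); so r times the integral is the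
average of √n·g_v, and each of these is close to r. -/
theorem abs_stieltjes_sub_one_le [DecidableRel G.Adj] {p r ε : ℝ} (hp : 0 ≤ p) (hr : 0 < r)
    (hr3 : r ≤ 1 / 3)
    (hdeg : ∀ v, |(G.degree v : ℝ) - p * Fintype.card V| ≤ ε * Fintype.card V) (L : ℕ) :
    r * |∫ x, (1 - x * r + p * r ^ 2)⁻¹ ∂(G.scaledMatchingMeasureReal : Measure ℝ) - 1| ≤
      ε + L / Fintype.card V + (1 / 4) ^ L := by
  classical
  set N : ℝ := ((Fintype.card V : ℕ) : ℝ) with hN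
  have hN0 : 0 < N := by rw [hN]; exact_mod_cast Fintype.card_pos
  have hsq : 0 < √N := Real.sqrt_pos.2 hN0
  set w : ℝ := 1 / r + p * r with hw
  have hw3 : 3 ≤ w := by
    have : 3 ≤ 1 / r := by rw [le_div_iff₀ hr]; linarith
    have : 0 ≤ p * r := by positivity
    linarith
  have hne : aeval ((√N * w : ℝ) : ℂ) G.matchingPolynomial ≠ 0 := by
    intro h
    have := norm_le_of_aeval_matchingPolynomial_eq_zero h
    rw [Complex.norm_real, Real.norm_of_nonneg (by positivity), ← hN] at this
    nlinarith
  have hg := norm_matchingRatio_sub_le hp hr hr3 hdeg L Finset.univ (L := L) (by simp)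
  have hroot : ∀ θ ∈ G.matchingPolynomial.aroots ℂ,
      (((1 - θ.re / √N * r + p * r ^ 2)⁻¹ : ℝ) : ℂ) =
        (r⁻¹ * √N : ℝ) * (1 / ((√N * w : ℝ) - θ)) := by
    intro θ hθ
    have him := im_eq_zero_of_aeval_matchingPolynomial_eq_zero (mem_aroots'.1 hθ).2
    have hre : θ = (θ.re : ℂ) := Complex.ext (by simp) (by simp [him])
    rw [hre, Complex.ofReal_re, ← Complex.ofReal_sub, ← Complex.ofReal_one, ← Complex.ofReal_div,
      ← Complex.ofReal_mul]
    congr 1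
    have hD : √N * w - θ.re = r⁻¹ * √N * (1 - θ.re / √N * r + p * r ^ 2) := by
      rw [hw]
      field_simp
      ring
    rw [hD, one_div, mul_inv, mul_inv_cancel_left₀ (by positivity)]
  have hsum : (((∫ x, (1 - x * r + p * r ^ 2)⁻¹ ∂(G.scaledMatchingMeasureReal : Measure ℝ) : ℝ) :
      ℂ) - 1) * r * N = ∑ v, (√N * G.matchingRatio Finset.univ (√N * w : ℝ) v - r) := by
    rw [G.integral_scaledMatchingMeasureReal (f := fun x => (1 - x * r + p * r ^ 2)⁻¹)
      (by fun_prop), ← hN, Finset.sum_sub_distrib, ← Finset.mul_sum, ← sum_matchingRatio hne]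
    rw [Complex.ofReal_div, ← Complex.ofRealHom_eq_coe, map_multiset_sum, Multiset.map_map]
    simp only [Function.comp_def, Complex.ofRealHom_eq_coe]
    rw [Multiset.map_congr rfl hroot, Multiset.sum_map_mul_left]
    have hrc : (r : ℂ) ≠ 0 := by exact_mod_cast hr.ne'
    have hNc : (N : ℂ) ≠ 0 := by exact_mod_cast hN0.ne'
    simp only [Finset.sum_const, Finset.card_univ, nsmul_eq_mul]
    rw [show ((Fintype.card V : ℕ) : ℂ) = (N : ℂ) by simp [hN]]
    push_cast
    field_simp
  have hnorm := congrArg norm hsum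
  rw [norm_mul, norm_mul, ← Complex.ofReal_one, ← Complex.ofReal_sub, Complex.norm_real,
    Complex.norm_real, Complex.norm_real, Real.norm_eq_abs, Real.norm_of_nonneg hr.le,
    Real.norm_of_nonneg hN0.le] at hnorm
  have hle := (norm_sum_le _ _).trans
    (Finset.sum_le_card_nsmul Finset.univ _ _ fun v hv => hg v hv)
  rw [← hnorm, nsmul_eq_mul, Finset.card_univ, ← hN, mul_comm N] at hle
  rw [mul_comm r]
  exact le_of_mul_le_mul_right hle hN0

end SimpleGraph

/-! ### Conclusion -/

theorem mainTheorem5 {Ω : Type*} [MeasurableSpace Ω] (P : Measure Ω) [IsProbabilityMeasure P]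
    (p : unitInterval) (hp0 : 0 < (p : ℝ)) (hp1 : (p : ℝ) < 1)
    (G : (n : ℕ+) → Ω → SimpleGraph (Fin n))
    (hG : ∀ n : ℕ+, HasLaw (G n) (SimpleGraph.binomialRandom (Fin n) p) P) :
    ∀ᵐ ω ∂P, Tendsto (fun n : ℕ+ => (G n ω).scaledMatchingMeasure) atTop
      (𝓝 (semicircleComplex (p : ℝ) hp0)) := by
  classical
  -- Countably many tolerances 1/(m+1) give one almost sure event that serves every r and η.
  have hdeg := ae_all_iff.2 fun m : ℕ =>
    SimpleGraph.ae_eventually_abs_degree_sub_le hG (ε := 1 / (m + 1)) (by positivity)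
  filter_upwards [hdeg] with ω hω
  have hreal : Tendsto (fun n : ℕ+ => (G n ω).scaledMatchingMeasureReal) atTop
      (𝓝 (semicircleReal p hp0)) := by
    refine tendsto_semicircleReal hp0 hp1.le
      (fun n => (G n ω).ae_abs_le_two_scaledMatchingMeasureReal) fun r hr hr3 => ?_
    rw [Metric.tendsto_nhds]
    intro η hη
    obtain ⟨m, hm⟩ := exists_nat_one_div_lt (by positivity : 0 < r * η / 3)
    -- The depth `L` is fixed before n grows, so that L/n also becomes small.
    obtain ⟨L, hL⟩ := exists_pow_lt_of_lt_one (by positivity : 0 < r * η / 3)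
      (by norm_num : (1 / 4 : ℝ) < 1)
    obtain ⟨M, hM⟩ := exists_nat_gt (L / (r * η / 3) : ℝ)
    filter_upwards [hω m, eventually_ge_atTop M.succPNat] with n hn hMn
    have h1 := (G n ω).abs_stieltjes_sub_one_le hp0.le hr hr3 (ε := 1 / (m + 1))
      (by simpa using hn) L
    rw [Fintype.card_fin] at h1
    have hn0 : (0 : ℝ) < n := by exact_mod_cast n.pos
    have hLn : (L : ℝ) / n < r * η / 3 := by
      have h2 : (M : ℝ) ≤ n := by
        have : M + 1 ≤ (n : ℕ) := PNat.coe_le_coe _ _ |>.2 hMn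
        exact_mod_cast (by omega : M ≤ (n : ℕ))
      rw [div_lt_iff₀ hn0, mul_comm]
      exact (div_lt_iff₀ (by positivity)).1 (hM.trans_le h2)
    rw [Real.dist_eq]
    exact lt_of_mul_lt_mul_left (by linarith) hr.le
  have := ProbabilityMeasure.tendsto_map_of_tendsto_of_continuous _ _ hreal
    (f := fun x : ℝ => (x : ℂ)) Complex.continuous_ofReal
  simp only [SimpleGraph.map_ofReal_scaledMatchingMeasureReal] at this
  exact this
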